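/- Let $\mathrm{LO}$ be the set of all $L\in 2^{\mathbb N\times\mathbb N}$ such that the relation $n\le_L m\iff L(n,m)=1$ is a (reflexive) linear order on $\mathbb N$; it is a closed subset of $2^{\mathbb N\times\mathbb N}$ and hence a Polish space. A linear order $L$ is right compressible if $L=L'+R$ with $L'\cong L$ and $R\neq\emptyset$, and left compressible if $L=R+L'$ with $L'\cong L$ and $R\neq\emptyset$ (here $L=A+B$ means that $A\cup B=L$ and every element of $A$ is strictly below every element of $B$). Let $\mathrm{LO}_r$ and $\mathrm{LO}_l$ be the sets of $L\in\mathrm{LO}$ that are right, respectively left, compressible. Let $\mathbf\Sigma^1_1$ be the class of analytic subsets of Polish spaces, $\mathbf\Pi^1_1$ the class of complements of analytic sets, and $D_2(\mathbf\Pi^1_1)$ the class of intersections of an analytic set with a coanalytic set. For $\Gamma$ one of these classes, a subset $A$ of a Polish space $Y$ is called $\Gamma$-complete if $A\in\Gamma(Y)$ and, for every zero-dimensional Polish space $X$ and every $B\in\Gamma(X)$, there is a continuous map $\varphi\colon X\to Y$ with $x\in B\iff\varphi(x)\in A$ for all $x\in X$. **Theorem.** (a) $\mathrm{LO}_l$,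 $\mathrm{LO}_r$ and $\mathrm{LO}_r\cap\mathrm{LO}_l$ are $\mathbf\Sigma^1_1$-complete. (b) $\mathrm{LO}\setminus(\mathrm{LO}_r\cup\mathrm{LO}_l)$ is $\mathbf\Pi^1_1$-complete. (c) $\mathrm{LO}_r\setminus\mathrm{LO}_l$ and $\mathrm{LO}_l\setminus\mathrm{LO}_r$ are $D_2(\mathbf\Pi^1_1)$-complete. -/

import Mathlib

open Set Topology MeasureTheory

universe u v

section PointClasses

/-- The three boldface classes of sets in Polish spaces that are considered. -/
inductive PointClass : Type
  | sigma11
  | pi11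
  | d2pi11

/-- `Γ.Mem A`: the subset `A` of the Polish space `X` belongs to the class `Γ`.
`Σ¹₁` is the class of analytic sets, `Π¹₁` the class of complements of analytic sets, and
`D₂(Π¹₁)` the class of intersections of an analytic set with a coanalytic set. -/
def PointClass.Mem (Γ : PointClass) {X : Type u} [TopologicalSpace X] [PolishSpace X]
    (A : Set X) : Prop :=
  match Γ with
  | .sigma11 => AnalyticSet A
  | .pi11 => AnalyticSet Aᶜ
  | .d2pi11 => ∃ S P : Set X, AnalyticSet S ∧ AnalyticSet Pᶜ ∧ A = S ∩ P

/-- A space is zero-dimensional if its clopen sets form a basis of the topology. -/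
def IsZeroDimensional (X : Type u) [TopologicalSpace X] : Prop :=
  TopologicalSpace.IsTopologicalBasis {s : Set X | IsClopen s}

/-- Wadge reducibility `B ≤_W A`: there is a continuous map `φ` with `x ∈ B ↔ φ x ∈ A`. -/
def WadgeReducible {X : Type u} {Y : Type v} [TopologicalSpace X] [TopologicalSpace Y]
    (B : Set X) (A : Set Y) : Prop :=
  ∃ φ : X → Y, Continuous φ ∧ ∀ x, x ∈ B ↔ φ x ∈ A

/-- `A` is `Γ`-hard: each set in `Γ(X)`, for each zero-dimensional Polish space `X`,
is Wadge reducible to `A`. -/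
def IsHard (Γ : PointClass) {Y : Type v} [TopologicalSpace Y] [PolishSpace Y]
    (A : Set Y) : Prop :=
  ∀ (X : Type u) [TopologicalSpace X] [PolishSpace X], IsZeroDimensional X →
    ∀ B : Set X, Γ.Mem B → WadgeReducible B A

/-- `A` is `Γ`-complete: it belongs to `Γ` and is `Γ`-hard. -/
def IsClassComplete (Γ : PointClass) {Y : Type v} [TopologicalSpace Y] [PolishSpace Y]
    (A : Set Y) : Prop :=
  Γ.Mem A ∧ IsHard.{u} Γ A

end PointClasses

section Compressibility

variable (L : Type u) [LinearOrder L]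

/-- The linear order `L` is the sum `A + B` of its suborders `A` and `B`. -/
def IsOrderSum {L : Type u} [LinearOrder L] (A B : Set L) : Prop :=
  A ∪ B = univ ∧ ∀ a ∈ A, ∀ b ∈ B, a < b

/-- `L = L' + R` with `L' ≅ L` and `R` nonempty. -/
def RightCompressible : Prop :=
  ∃ L' R : Set L, IsOrderSum L' R ∧ Nonempty (L' ≃o L) ∧ R.Nonempty

/-- `L = R + L'` with `L' ≅ L` and `R` nonempty. -/
def LeftCompressible : Prop :=
  ∃ R L' : Set L, IsOrderSum R L' ∧ Nonempty (L' ≃o L) ∧ R.Nonempty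

end Compressibility

section CodedOrders

/-- The elements of `2^(ℕ × ℕ)` coding a (reflexive) linear order on `ℕ`, where `L` codes
the relation holding between `n` and `m` iff `L (n, m)` is true. -/
def linearOrderCodes : Set (ℕ × ℕ → Bool) :=
  {L | (∀ n, L (n, n) = true) ∧
    (∀ n m, L (n, m) = true → L (m, n) = true → n = m) ∧
    (∀ n m k, L (n, m) = true → L (m, k) = true → L (n, k) = true) ∧
    (∀ n m, L (n, m) = true ∨ L (m, n) = true)}

/-- The space of linear orders on `ℕ`, with the topology inherited from `2^(ℕ × ℕ)`. -/
abbrev LO : Type := linearOrderCodes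

theorem isClosed_linearOrderCodes : IsClosed linearOrderCodes := by
  have hev : ∀ p : ℕ × ℕ, IsClopen {L : ℕ × ℕ → Bool | L p = true} := fun p =>
    (isClopen_discrete {true}).preimage (continuous_apply p)
  simp only [linearOrderCodes, ofPred_and, ofPred_forall, imp_iff_not_or, ofPred_or]
  refine IsClosed.inter (isClosed_iInter fun n => (hev _).isClosed) (IsClosed.inter ?_
    (IsClosed.inter ?_ ?_))
  · exact isClosed_iInter fun n => isClosed_iInter fun m =>
      (hev _).compl.isClosed.union ((hev _).compl.isClosed.union isClosed_const)
  · exact isClosed_iInter fun n => isClosed_iInter fun m => isClosed_iInter fun k =>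
      (hev _).compl.isClosed.union ((hev _).compl.isClosed.union (hev _).isClosed)
  · exact isClosed_iInter fun n => isClosed_iInter fun m =>
      (hev _).isClosed.union (hev _).isClosed

instance instPolishSpaceLO : PolishSpace LO := by
  have hs : SecondCountableTopology (ℕ × ℕ → Bool) := inferInstance
  have hm : TopologicalSpace.IsCompletelyMetrizableSpace (ℕ × ℕ → Bool) := inferInstance
  have : PolishSpace (ℕ × ℕ → Bool) := inferInstance
  exact isClosed_linearOrderCodes.polishSpace

/-- The set `ℕ`, regarded as the domain of the linear order coded by `L`. -/
def LO.Dom (_L : LO) : Type := ℕ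

/-- The linear order on `ℕ` coded by `L`. -/
instance LO.instLinearOrderDom (L : LO) : LinearOrder L.Dom where
  le n m := L.1 (n, m) = true
  le_refl := L.2.1
  le_trans := L.2.2.2.1
  le_antisymm := L.2.2.1
  le_total := L.2.2.2.2
  toDecidableLE := fun n m => inferInstanceAs (Decidable (L.1 (n, m) = true))

/-- The set of (codes for) right compressible linear orders on `ℕ`. -/
def LOr : Set LO := {L | RightCompressible L.Dom}

/-- The set of (codes for) left compressible linear orders on `ℕ`. -/
def LOl : Set LO := {L | LeftCompressible L.Dom}

end CodedOrders

/-! ### Initial self-embeddings and compressibility of products and sums -/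

section RightCompressible

variable {L M : Type*} [LinearOrder L] [LinearOrder M]

/-! Write 2^α for `Colex (Finset α)`, the finite subsets of α compared at their largest difference.
If α is a well-order, so is 2^α, and no well-order is isomorphic to a proper initial segment of
itself. If α is countable and has a descending sequence, let I be the upper set that the sequence
generates. Then 2^I is countable and dense with a least and no greatest element, so by Cantor's
theorem it is isomorphic to a proper initial segment of itself. This passes to 2^α, the
lexicographic product of 2^I and 2^(α∖I). Thus ill-foundedness turns into right compressibility.

To control both sides independently, form (2^β·2)* + ℚ + 2^α·2. Doubling gives each point of the
outer summands an immediate neighbour, while points of ℚ have none, so an isomorphism onto an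
initial segment cannot move points across ℚ. The sum is right compressible iff α is ill-founded
(`rightCompressible_separatedSum_iff`) and, by reversal, left compressible iff β is.

Kleene–Brouwer orders reduce analytic sets continuously to ill-foundedness. Hence one continuous map
reduces any pair of analytic sets to the pair (`LOr`, `LOl`), which yields every hardness claim. The
upper bounds hold because `LOr` is the projection of a Borel set. -/

theorem rightCompressible_iff_exists_orderEmbedding :
    RightCompressible L ↔ ∃ f : L ↪o L, IsLowerSet (range f) ∧ ¬ Function.Surjective f := by
  constructor
  · rintro ⟨A, B, ⟨hAB, hlt⟩, ⟨e⟩, b, hb⟩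
    have hr : range (e.symm.toOrderEmbedding.trans (OrderEmbedding.subtype (· ∈ A))) = A := by
      ext x
      constructor
      · rintro ⟨y, rfl⟩
        exact (e.symm y).2
      · intro hx
        exact ⟨e ⟨x, hx⟩, by simp⟩
    refine ⟨e.symm.toOrderEmbedding.trans (OrderEmbedding.subtype (· ∈ A)), ?_, ?_⟩
    · rw [hr]
      intro x y hyx hx
      rcases (hAB.symm ▸ mem_univ y : y ∈ A ∪ B) with h | h
      · exact h
      · exact absurd (hlt x hx y h) hyx.not_gt
    · intro hs
      have : b ∈ A := hr ▸ hs b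
      exact lt_irrefl b (hlt b this b hb)
  · rintro ⟨f, hf, hs⟩
    refine ⟨range f, (range f)ᶜ, ⟨union_compl_self _, fun a ha b hb => ?_⟩,
      ⟨f.orderIso.symm⟩, ?_⟩
    · by_contra h
      exact hb (hf (not_lt.1 h) ha)
    · rwa [nonempty_compl, Ne, range_eq_univ]

theorem leftCompressible_iff_rightCompressible_orderDual :
    LeftCompressible L ↔ RightCompressible Lᵒᵈ := by
  constructor
  · rintro ⟨R, A, ⟨hu, hlt⟩, ⟨e⟩, hR⟩
    exact ⟨A, R, ⟨(union_comm A R).trans hu, fun a ha b hb => hlt b hb a ha⟩, ⟨e.dual⟩, hR⟩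
  · rintro ⟨A, R, ⟨hu, hlt⟩, ⟨e⟩, hR⟩
    exact ⟨R, A, ⟨(union_comm R A).trans hu, fun a ha b hb => hlt b hb a ha⟩, ⟨e.dual⟩, hR⟩

theorem RightCompressible.of_orderIso (e : L ≃o M) (h : RightCompressible L) :
    RightCompressible M := by
  obtain ⟨f, hf, hs⟩ := rightCompressible_iff_exists_orderEmbedding.1 h
  refine rightCompressible_iff_exists_orderEmbedding.2
    ⟨(e.symm.toOrderEmbedding.trans f).trans e.toOrderEmbedding, ?_, fun hsur => hs fun x => ?_⟩
  · rintro _ y hy ⟨x, rfl⟩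
    obtain ⟨z, hz⟩ := hf (show e.symm y ≤ f (e.symm x) from (e.symm_apply_le).2 hy) ⟨_, rfl⟩
    exact ⟨e z, by simp [hz]⟩
  · obtain ⟨y, hy⟩ := hsur (e x)
    exact ⟨e.symm y, by simpa using hy⟩

theorem OrderIso.rightCompressible_iff (e : L ≃o M) :
    RightCompressible L ↔ RightCompressible M :=
  ⟨.of_orderIso e, .of_orderIso e.symm⟩

theorem OrderIso.leftCompressible_iff (e : L ≃o M) :
    LeftCompressible L ↔ LeftCompressible M := by
  simp only [leftCompressible_iff_rightCompressible_orderDual]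
  exact e.dual.rightCompressible_iff

theorem RightCompressible.prodLex [Nonempty M] (h : RightCompressible L) :
    RightCompressible (L ×ₗ M) := by
  obtain ⟨f, hf, hs⟩ := rightCompressible_iff_exists_orderEmbedding.1 h
  let g : L ×ₗ M → L ×ₗ M := fun p => toLex (f (ofLex p).1, (ofLex p).2)
  have hg : StrictMono g := by
    intro p q hpq
    rw [Prod.Lex.lt_iff] at hpq
    simpa [g, Prod.Lex.toLex_lt_toLex] using hpq
  refine rightCompressible_iff_exists_orderEmbedding.2
    ⟨OrderEmbedding.ofStrictMono g hg, ?_, fun hsur => hs fun x => ?_⟩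
  · rintro _ q hq ⟨p, rfl⟩
    obtain ⟨x, hx⟩ := hf (Prod.Lex.monotone_fst _ _ hq) ⟨(ofLex p).1, rfl⟩
    exact ⟨toLex (x, (ofLex q).2), by simp [g, hx]⟩
  · obtain ⟨m⟩ := ‹Nonempty M›
    obtain ⟨p, hp⟩ := hsur (toLex (x, m))
    exact ⟨(ofLex p).1, congrArg (fun z => (ofLex z).1) hp⟩

theorem RightCompressible.sumLex (h : RightCompressible M) : RightCompressible (L ⊕ₗ M) := by
  obtain ⟨f, hf, hs⟩ := rightCompressible_iff_exists_orderEmbedding.1 h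
  let g : L ⊕ₗ M → L ⊕ₗ M := fun p => toLex (Sum.map id f (ofLex p))
  have hg : StrictMono g := by
    rintro (a | a) (b | b) hab
    · exact Sum.Lex.inl_lt_inl_iff.2 (Sum.Lex.inl_lt_inl_iff.1 hab)
    · exact Sum.Lex.inl_lt_inr _ _
    · exact absurd hab Sum.Lex.not_inr_lt_inl
    · exact Sum.Lex.inr_lt_inr_iff.2 (f.lt_iff_lt.2 (Sum.Lex.inr_lt_inr_iff.1 hab))
  refine rightCompressible_iff_exists_orderEmbedding.2
    ⟨OrderEmbedding.ofStrictMono g hg, ?_, fun hsur => hs fun x => ?_⟩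
  · rintro _ (b | b) hq ⟨a | a, rfl⟩
    · exact ⟨toLex (.inl b), rfl⟩
    · exact ⟨toLex (.inl b), rfl⟩
    · exact absurd hq Sum.Lex.not_inr_le_inl
    · obtain ⟨x, hx⟩ := hf (Sum.Lex.inr_le_inr_iff.1 hq) ⟨a, rfl⟩
      exact ⟨toLex (.inr x), congrArg (fun z => toLex (Sum.inr z)) hx⟩
  · obtain ⟨a | a, ha⟩ := hsur (toLex (.inr x))
    · exact absurd (toLex.injective ha : (Sum.inl a : L ⊕ M) = Sum.inr x) Sum.inl_ne_inr
    · exact ⟨a, Sum.inr_injective (toLex.injective ha)⟩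

/-- By Cantor's theorem the points above `⊥` are isomorphic to those strictly between `⊥` and any `q
> ⊥`; fixing `⊥` extends this to an isomorphism onto the initial segment below `q`. -/
theorem rightCompressible_of_denselyOrdered [OrderBot L] [Countable L] [DenselyOrdered L]
    [NoMaxOrder L] : RightCompressible L := by
  obtain ⟨q, hq⟩ := exists_gt (⊥ : L)
  have : Nonempty (Ioi (⊥ : L)) := ⟨⟨q, hq⟩⟩
  have : Nonempty (Ioo (⊥ : L) q) := let ⟨r, hr⟩ := exists_between hq; ⟨⟨r, hr⟩⟩
  obtain ⟨e⟩ := Order.iso_of_countable_dense (Ioi (⊥ : L)) (Ioo (⊥ : L) q)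
  classical
  let f : L → L := fun x => if h : ⊥ < x then e ⟨x, h⟩ else ⊥
  have hf0 : f ⊥ = ⊥ := by simp [f]
  have hf1 : ∀ x (h : ⊥ < x), f x = e ⟨x, h⟩ := fun x h => by simp [f, h]
  have hf : StrictMono f := by
    intro x y hxy
    have hy : ⊥ < y := bot_le.trans_lt hxy
    rw [hf1 y hy]
    rcases eq_bot_or_bot_lt x with rfl | hx
    · rw [hf0]
      exact (e ⟨y, hy⟩).2.1
    · rw [hf1 x hx]
      exact e.strictMono (a := ⟨x, hx⟩) (b := ⟨y, hy⟩) hxy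
  have hlt : ∀ x, f x < q := fun x => by
    rcases eq_bot_or_bot_lt x with rfl | hx
    · rwa [hf0]
    · rw [hf1 x hx]
      exact (e ⟨x, hx⟩).2.2
  refine rightCompressible_iff_exists_orderEmbedding.2
    ⟨OrderEmbedding.ofStrictMono f hf, ?_, fun hs => ?_⟩
  · rintro _ y hy ⟨x, rfl⟩
    rcases eq_bot_or_bot_lt y with rfl | hy0
    · exact ⟨⊥, hf0⟩
    · obtain ⟨⟨z, hz⟩, hze⟩ := e.surjective ⟨y, hy0, hy.trans_lt (hlt x)⟩
      exact ⟨z, by simp [hf1 z hz, hze]⟩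
  · obtain ⟨x, hx⟩ := hs q
    exact (hlt x).ne hx

end RightCompressible

/-! ### Finite subsets in the colexicographic order: well-foundedness and density -/

section Colex

open Finset.Colex

variable {α : Type*} [LinearOrder α]

instance Finset.Colex.instWellFoundedLT [WellFoundedLT α] : WellFoundedLT (Colex (Finset α)) := by
  -- Passing from `t` down to `s` replaces the elements of `t \ s` by elements of `s \ t`, all below
  -- some `w ∈ t \ s`: a step of the Dershowitz–Manna multiset order.
  refine ⟨Subrelation.wf ?_ (InvImage.wf (fun s : Colex (Finset α) => (ofColex s).val)
    (Multiset.wellFounded_isDershowitzMannaLT (α := α)))⟩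
  intro s t hst
  obtain ⟨w, hwt, hws, hw⟩ := lt_iff_exists_forall_lt.1 hst
  refine ⟨(ofColex s ∩ ofColex t).val, (ofColex s \ ofColex t).val, (ofColex t \ ofColex s).val,
    ?_, ?_, ?_, ?_⟩
  · intro h
    have : w ∈ (ofColex t \ ofColex s).val := Finset.mem_sdiff.2 ⟨hwt, hws⟩
    rw [h] at this
    exact Multiset.notMem_zero _ this
  · rw [add_comm, ← Finset.disjUnion_val (h := Finset.disjoint_sdiff_inter _ _),
      Finset.disjUnion_eq_union, Finset.sdiff_union_inter]
  · rw [add_comm, Finset.inter_comm,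
      ← Finset.disjUnion_val (h := Finset.disjoint_sdiff_inter _ _),
      Finset.disjUnion_eq_union, Finset.sdiff_union_inter]
  · intro y hy
    rw [Finset.mem_val, Finset.mem_sdiff] at hy
    exact ⟨w, Finset.mem_sdiff.2 ⟨hwt, hws⟩, hw y hy.1 hy.2⟩

theorem exists_forall_mem_finset_lt [NoMinOrder α] [Nonempty α] (s : Finset α) :
    ∃ a, ∀ x ∈ s, a < x := by
  obtain ⟨b, hb⟩ := (s : Set α).toFinite.bddBelow
  obtain ⟨a, ha⟩ := exists_lt b
  exact ⟨a, fun x hx => ha.trans_le (hb hx)⟩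

instance Finset.Colex.instDenselyOrdered [NoMinOrder α] : DenselyOrdered (Colex (Finset α)) where
  dense s t hst := by
    obtain ⟨w, hwt, hws, hw⟩ := lt_iff_exists_forall_lt.1 hst
    have : Nonempty α := ⟨w⟩
    -- Adding a point below everything in sight enlarges `s` without affecting its comparison with
    -- `t` at `w`.
    obtain ⟨a, ha⟩ := exists_forall_mem_finset_lt (ofColex s ∪ ofColex t)
    have has : a ∉ ofColex s := fun h => lt_irrefl a (ha a (by simp [h]))
    have haw : a < w := ha w (by simp [hwt])
    refine ⟨toColex (insert a (ofColex s)), ?_, ?_⟩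
    · exact toColex_lt_toColex_of_ssubset (Finset.ssubset_insert has)
    · refine lt_iff_exists_forall_lt.2 ⟨w, hwt, by simp [haw.ne', hws], fun x hx hxt => ?_⟩
      rcases Finset.mem_insert.1 hx with rfl | hx
      · exact haw
      · exact hw x hx hxt

instance Finset.Colex.instNoMaxOrder [NoMinOrder α] [Nonempty α] :
    NoMaxOrder (Colex (Finset α)) where
  exists_gt s := by
    obtain ⟨a, ha⟩ := exists_forall_mem_finset_lt (ofColex s)
    exact ⟨toColex (insert a (ofColex s)),
      toColex_lt_toColex_of_ssubset (Finset.ssubset_insert fun h => lt_irrefl a (ha a h))⟩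

instance Finset.Colex.instCountable [Countable α] : Countable (Colex (Finset α)) :=
  inferInstanceAs (Countable (Finset α))

/-- Finite subsets of `α` in the colexicographic order are determined lexicographically by their
trace on an upper set and their trace on its complement. -/
theorem nonempty_colex_orderIso_prodLex {I : Set α} (hI : IsUpperSet I) :
    Nonempty (Colex (Finset α) ≃o
      Colex (Finset {x // x ∈ I}) ×ₗ Colex (Finset {x // x ∉ I})) := by
  classical
  let g : Colex (Finset α) → Colex (Finset {x // x ∈ I}) ×ₗ Colex (Finset {x // x ∉ I}) :=
    fun s => toLex (toColex ((ofColex s).subtype (· ∈ I)), toColex ((ofColex s).subtype (· ∉ I)))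
  have hmono : Monotone g := by
    intro s t hst
    rw [Prod.Lex.toLex_le_toLex]
    by_cases h : (ofColex s).subtype (· ∈ I) = (ofColex t).subtype (· ∈ I)
    · refine .inr ⟨congrArg toColex h, ?_⟩
      rintro ⟨a, haI⟩ has hat
      simp only [ofColex_toColex, Finset.mem_subtype] at has hat
      obtain ⟨b, hbt, hbs, hab⟩ := hst has hat
      -- The traces on `I` agree, so the witness `b` must lie outside `I`.
      have hb : b ∉ I := fun hb => hbs <| by
        have := Finset.ext_iff.1 h ⟨b, hb⟩
        simpa [hbt] using this
      exact ⟨⟨b, hb⟩, by simpa using hbt, by simpa using hbs, hab⟩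
    · refine .inl (lt_of_le_of_ne ?_ fun h' => h (toColex.injective h'))
      rintro ⟨a, haI⟩ has hat
      simp only [ofColex_toColex, Finset.mem_subtype] at has hat
      obtain ⟨b, hbt, hbs, hab⟩ := hst has hat
      exact ⟨⟨b, hI hab haI⟩, by simpa using hbt, by simpa using hbs, hab⟩
  have hinj : Function.Injective g := by
    intro s t hst
    have h := Prod.ext_iff.1 (toLex.injective hst)
    have h1 := Finset.ext_iff.1 (toColex.injective h.1)
    have h2 := Finset.ext_iff.1 (toColex.injective h.2)
    apply ofColex.injective
    ext x
    by_cases hx : x ∈ I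
    · simpa using h1 ⟨x, hx⟩
    · simpa using h2 ⟨x, hx⟩
  refine ⟨StrictMono.orderIsoOfSurjective g (hmono.strictMono_of_injective hinj) fun p => ?_⟩
  refine ⟨toColex ((ofColex (ofLex p).1).map (Function.Embedding.subtype _) ∪
    (ofColex (ofLex p).2).map (Function.Embedding.subtype _)), ?_⟩
  apply ofLex.injective
  refine Prod.ext ?_ ?_
  · apply ofColex.injective
    ext ⟨x, hx⟩
    simp [g, hx]
  · apply ofColex.injective
    ext ⟨x, hx⟩
    simp [g, hx]

theorem rightCompressible_colex [Countable α] (h : ¬ WellFoundedLT α) :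
    RightCompressible (Colex (Finset α)) := by
  rw [WellFoundedLT, isWellFounded_iff, RelEmbedding.wellFounded_iff_isEmpty, not_isEmpty_iff] at h
  obtain ⟨d⟩ := h
  have hd : ∀ n, d (n + 1) < d n := fun n => d.map_rel_iff.2 n.lt_succ_self
  let I : Set α := {x | ∃ n, d n ≤ x}
  have hI : IsUpperSet I := fun x y hxy ⟨n, hn⟩ => ⟨n, hn.trans hxy⟩
  have : Nonempty {x // x ∈ I} := ⟨⟨d 0, 0, le_rfl⟩⟩
  have : NoMinOrder {x // x ∈ I} :=
    ⟨fun ⟨x, n, hn⟩ => ⟨⟨d (n + 1), n + 1, le_rfl⟩, (hd n).trans_le hn⟩⟩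
  obtain ⟨e⟩ := nonempty_colex_orderIso_prodLex hI
  exact .of_orderIso e.symm (.prodLex rightCompressible_of_denselyOrdered)

end Colex

/-! ### Separating the two sides by a dense block -/

section Separated

/-- The order `2^α`, given by the finite subsets of `α`, with each point doubled. -/
abbrev DoubledColex (α : Type*) : Type _ := Colex (Finset α) ×ₗ Bool

/-- The order `(2^β · 2)* + D + 2^α · 2`. -/
abbrev SeparatedSum (D α β : Type*) : Type _ :=
  (DoubledColex β)ᵒᵈ ⊕ₗ (D ⊕ₗ DoubledColex α)

variable {A B D : Type*} [LinearOrder A] [LinearOrder B] [LinearOrder D]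

theorem exists_covBy_prodLex_bool (p : A ×ₗ Bool) : ∃ q, p ⋖ q ∨ q ⋖ p := by
  obtain ⟨a, b⟩ := p
  have h : (toLex (a, false) : A ×ₗ Bool) ⋖ toLex (a, true) := by
    rw [Prod.Lex.toLex_covBy_toLex_iff]
    exact .inl ⟨rfl, by decide⟩
  cases b
  · exact ⟨_, .inl h⟩
  · exact ⟨_, .inr h⟩

theorem exists_covBy_orderDual (h : ∀ a : A, ∃ a', a ⋖ a' ∨ a' ⋖ a) (a : Aᵒᵈ) :
    ∃ a', a ⋖ a' ∨ a' ⋖ a := by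
  obtain ⟨b, hb | hb⟩ := h (OrderDual.ofDual a)
  · exact ⟨OrderDual.toDual b, .inr ⟨hb.1, fun _ h1 h2 => hb.2 h2 h1⟩⟩
  · exact ⟨OrderDual.toDual b, .inl ⟨hb.1, fun _ h1 h2 => hb.2 h2 h1⟩⟩

/-- Covering relations inside the well-order `B` and inside `A` keep a self-embedding onto an
initial segment from moving points across the dense part `D`. -/
theorem not_rightCompressible_sumLex_dense [DenselyOrdered D] [NoMinOrder D] [NoMaxOrder D]
    [Nonempty D] [Nonempty B] [WellFoundedLT B] (hA : ∀ a : A, ∃ a', a ⋖ a' ∨ a' ⋖ a)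
    (hB : ∀ b : B, ∃ b', b ⋖ b' ∨ b' ⋖ b) : ¬ RightCompressible (A ⊕ₗ (D ⊕ₗ B)) := by
  rw [rightCompressible_iff_exists_orderEmbedding]
  rintro ⟨f, hf, hs⟩
  let iA : A ↪o A ⊕ₗ (D ⊕ₗ B) := .ofStrictMono _ Sum.Lex.inl_strictMono
  let iD : D ↪o A ⊕ₗ (D ⊕ₗ B) := .ofStrictMono _
    (Sum.Lex.inr_strictMono.comp Sum.Lex.inl_strictMono)
  let iB : B ↪o A ⊕ₗ (D ⊕ₗ B) := .ofStrictMono _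
    (Sum.Lex.inr_strictMono.comp Sum.Lex.inr_strictMono)
  have hAD : ∀ a d, iA a < iD d := fun a d => Sum.Lex.inl_lt_inr _ _
  have hDB : ∀ d b, iD d < iB b :=
    fun d b => Sum.Lex.inr_lt_inr_iff.2 (Sum.Lex.inl_lt_inr _ _)
  have hcases : ∀ x, (∃ a, x = iA a) ∨ (∃ d, x = iD d) ∨ ∃ b, x = iB b := by
    rintro (a | d | b)
    · exact .inl ⟨a, rfl⟩
    · exact .inr (.inl ⟨d, rfl⟩)
    · exact .inr (.inr ⟨b, rfl⟩)
  -- Convexity of the summand makes covers inside it covers in the whole sum.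
  have hcA : (range iA).OrdConnected := by
    refine IsLowerSet.ordConnected ?_
    rintro _ y hy ⟨a, rfl⟩
    rcases hcases y with ⟨b, rfl⟩ | ⟨d, rfl⟩ | ⟨b, rfl⟩
    · exact ⟨b, rfl⟩
    · exact absurd (hAD a d) hy.not_gt
    · obtain ⟨d⟩ := ‹Nonempty D›
      exact absurd ((hAD a d).trans (hDB d b)) hy.not_gt
  have hcB : (range iB).OrdConnected := by
    refine IsUpperSet.ordConnected ?_
    rintro _ y hy ⟨b, rfl⟩
    rcases hcases y with ⟨a, rfl⟩ | ⟨d, rfl⟩ | ⟨b, rfl⟩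
    · obtain ⟨d⟩ := ‹Nonempty D›
      exact absurd ((hAD a d).trans (hDB d b)) hy.not_gt
    · exact absurd (hDB d b) hy.not_gt
    · exact ⟨b, rfl⟩
  have hnA : ∀ a, ∃ y, iA a ⋖ y ∨ y ⋖ iA a := fun a => by
    obtain ⟨a', h | h⟩ := hA a
    · exact ⟨_, .inl (h.image iA hcA)⟩
    · exact ⟨_, .inr (h.image iA hcA)⟩
  have hnB : ∀ b, ∃ y, iB b ⋖ y ∨ y ⋖ iB b := fun b => by
    obtain ⟨b', h | h⟩ := hB b
    · exact ⟨_, .inl (h.image iB hcB)⟩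
    · exact ⟨_, .inr (h.image iB hcB)⟩
  -- Density excludes neighbours inside `D`; the absence of endpoints excludes neighbours in `A` and
  -- `B`.
  have hD : ∀ d y, ¬ (iD d ⋖ y) ∧ ¬ (y ⋖ iD d) := by
    intro d y
    obtain ⟨d1, h1⟩ := exists_lt d
    obtain ⟨d2, h2⟩ := exists_gt d
    rcases hcases y with ⟨a, rfl⟩ | ⟨d', rfl⟩ | ⟨b, rfl⟩
    · exact ⟨fun h => h.1.not_gt (hAD a d), fun h => h.2 (hAD a d1) (iD.lt_iff_lt.2 h1)⟩
    · exact ⟨fun h => not_covBy (h.of_image iD), fun h => not_covBy (h.of_image iD)⟩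
    · exact ⟨fun h => h.2 (iD.lt_iff_lt.2 h2) (hDB d2 b), fun h => h.1.not_gt (hDB d b)⟩
  have hcov : ∀ x y, x ⋖ y → f x ⋖ f y := fun x y h => h.image f hf.ordConnected
  have hfD : ∀ d, ∃ d', f (iD d) = iD d' := by
    intro d
    -- A neighbour of the image would lie in the initial segment `range f` (an upper one is at most
    -- `f (iD d2)`), hence pull back to a neighbour of `iD d`.
    have key : ∀ y, ¬ (f (iD d) ⋖ y) ∧ ¬ (y ⋖ f (iD d)) := by
      refine fun y => ⟨fun h => ?_, fun h => ?_⟩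
      · obtain ⟨d2, h2⟩ := exists_gt d
        obtain ⟨z, rfl⟩ := hf (h.ge_of_gt (f.lt_iff_lt.2 (iD.lt_iff_lt.2 h2))) ⟨_, rfl⟩
        exact (hD d z).1 (h.of_image f)
      · obtain ⟨z, rfl⟩ := hf h.le ⟨_, rfl⟩
        exact (hD d z).2 (h.of_image f)
    rcases hcases (f (iD d)) with ⟨a, ha⟩ | h | ⟨b, hb⟩
    · obtain ⟨y, hy⟩ := hnA a
      rw [← ha] at hy
      exact absurd hy (not_or.2 (key y))
    · exact h
    · obtain ⟨y, hy⟩ := hnB b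
      rw [← hb] at hy
      exact absurd hy (not_or.2 (key y))
  have hfB : ∀ b, ∃ b', f (iB b) = iB b' := by
    intro b
    obtain ⟨d⟩ := ‹Nonempty D›
    obtain ⟨d', hd'⟩ := hfD d
    have hlt : iD d' < f (iB b) := hd' ▸ f.lt_iff_lt.2 (hDB d b)
    rcases hcases (f (iB b)) with ⟨a, ha⟩ | ⟨e, he⟩ | h
    · exact absurd (hAD a d') (ha ▸ hlt).not_gt
    · obtain ⟨y, hy | hy⟩ := hnB b
      · exact absurd (he ▸ hcov _ _ hy) (hD e _).1
      · exact absurd (he ▸ hcov _ _ hy) (hD e _).2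
    · exact h
  choose g hg using hfB
  have hgm : StrictMono g := fun b b' h => by
    rw [← iB.lt_iff_lt, ← hg, ← hg]
    exact f.lt_iff_lt.2 (iB.lt_iff_lt.2 h)
  -- A strictly increasing self-map of a well-order satisfies `b ≤ g b`, so the initial segment
  -- `range f` contains all of `B`, and therefore everything.
  have hBr : ∀ b, iB b ∈ range f := fun b =>
    hf (iB.le_iff_le.2 hgm.le_apply) ⟨iB b, hg b⟩
  refine hs fun x => ?_
  obtain ⟨b⟩ := ‹Nonempty B›
  obtain ⟨d⟩ := ‹Nonempty D›
  rcases hcases x with ⟨a, rfl⟩ | ⟨d, rfl⟩ | ⟨b, rfl⟩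
  · exact hf ((hAD a d).trans (hDB d b)).le (hBr b)
  · exact hf (hDB d b).le (hBr b)
  · exact hBr b

variable {α β : Type*} [LinearOrder α] [LinearOrder β] [DenselyOrdered D] [NoMinOrder D]
  [NoMaxOrder D] [Nonempty D]

theorem rightCompressible_separatedSum_iff [Countable α] :
    RightCompressible (SeparatedSum D α β) ↔ ¬ WellFoundedLT α := by
  refine ⟨fun h hw => ?_, fun h => .sumLex (.sumLex (.prodLex (rightCompressible_colex h)))⟩
  exact not_rightCompressible_sumLex_dense (exists_covBy_orderDual exists_covBy_prodLex_bool)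
    exists_covBy_prodLex_bool h

/-- Reversing a separated sum exchanges its outer summands. -/
def separatedSumDual (D α β : Type*) [LinearOrder α] [LinearOrder β] [LinearOrder D] :
    (SeparatedSum D α β)ᵒᵈ ≃o SeparatedSum Dᵒᵈ β α :=
  (OrderIso.sumLexDualAntidistrib _ _).trans <|
    (OrderIso.sumLexCongr (OrderIso.sumLexDualAntidistrib _ _) (OrderIso.dualDual _).symm).trans
      (OrderIso.sumLexAssoc _ _ _)

theorem leftCompressible_separatedSum_iff [Countable β] :
    LeftCompressible (SeparatedSum D α β) ↔ ¬ WellFoundedLT β := by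
  rw [leftCompressible_iff_rightCompressible_orderDual,
    (separatedSumDual D α β).rightCompressible_iff, rightCompressible_separatedSum_iff]

end Separated

/-! ### Analytic sets as Suslin operations on clopen sets -/

section Scheme

theorem isClopen_setOf_const {X : Type*} [TopologicalSpace X] (p : Prop) :
    IsClopen {_x : X | p} := by
  by_cases h : p
  · simp [h, isClopen_univ]
  · simp [h, isClopen_empty]

/-- An analytic set in a zero-dimensional space is obtained from a decreasing scheme of clopen
sets by the Suslin operation. -/
theorem MeasureTheory.AnalyticSet.exists_clopen_scheme {X : Type*} [TopologicalSpace X]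
    [PolishSpace X] (hX : IsZeroDimensional X) {B : Set X} (hB : AnalyticSet B) :
    ∃ C : List ℕ → Set X, (∀ s, IsClopen (C s)) ∧ (∀ s t, C (s ++ t) ⊆ C s) ∧
      ∀ x, x ∈ B ↔ ∃ y : ℕ → ℕ, ∀ n, x ∈ C ((List.range n).map y) := by
  rw [AnalyticSet] at hB
  rcases hB with rfl | ⟨g, hg, rfl⟩
  · exact ⟨fun _ => ∅, fun _ => isClopen_empty, fun _ _ => subset_rfl, by simp⟩
  obtain ⟨S, hSc, hS, hSb⟩ := hX.exists_countable
  have hne : S.Nonempty := by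
    obtain ⟨u, hu, -⟩ := hSb.exists_subset_of_mem_open (mem_univ (g 0)) isOpen_univ
    exact ⟨u, hu⟩
  obtain ⟨U, rfl⟩ := hS.exists_eq_range hne
  have hU : ∀ k, IsClopen (U k) := fun k => hSc ⟨k, rfl⟩
  let N : List ℕ → Set (ℕ → ℕ) := fun s => {y | ∀ i < s.length, s[i]? = some (y i)}
  have hN : ∀ y n, N ((List.range n).map y) = {z | ∀ i < n, y i = z i} := by
    intro y n
    ext z
    simp only [N, mem_ofPred_eq, List.length_map, List.length_range]
    refine forall₂_congr fun i hi => ?_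
    simp [hi]
  -- Only the first `s.length` basic sets are tested, so `C s` is clopen: whenever one of them
  -- contains `x`, it must meet the image under `g` of the cylinder `N s`.
  refine ⟨fun s => ⋂ k ∈ Finset.range s.length,
    {x | x ∈ U k → (N s ∩ g ⁻¹' U k).Nonempty}, fun s => ?_, fun s t x hx => ?_, fun x => ?_⟩
  · refine isClopen_biInter_finset fun k _ => ?_
    by_cases h : (N s ∩ g ⁻¹' U k).Nonempty
    · simp [h, isClopen_univ]
    · simp only [h, imp_false]
      exact (hU k).compl
  · simp only [mem_iInter, Finset.mem_range] at hx ⊢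
    intro k hk hxk
    obtain ⟨y, hy, hyk⟩ := hx k (by simp; omega) hxk
    refine ⟨y, fun i hi => ?_, hyk⟩
    rw [← hy i (by simp; omega), List.getElem?_append_left hi]
  · constructor
    · rintro ⟨y, rfl⟩
      refine ⟨y, fun n => ?_⟩
      simp only [mem_iInter]
      exact fun k _ hk => ⟨y, by simp [hN], hk⟩
    · rintro ⟨y, hy⟩
      refine ⟨y, ?_⟩
      have hmem : ∀ k, x ∈ U k → g y ∈ U k := by
        intro k hk
        -- Length `n + k + 1` exceeds `k`, so the test for `U k` is active; as `n` grows the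
        -- witnesses converge to `y`, and `U k` is closed.
        have : ∀ n, ∃ z, (∀ i < n + k + 1, y i = z i) ∧ g z ∈ U k := by
          intro n
          have h := hy (n + k + 1)
          simp only [mem_iInter] at h
          obtain ⟨z, hz, hzk⟩ := h k (by simp) hk
          rw [hN] at hz
          exact ⟨z, hz, hzk⟩
        choose z hz hzk using this
        have hlim : Filter.Tendsto z Filter.atTop (𝓝 y) := by
          rw [tendsto_pi_nhds]
          intro i
          refine tendsto_const_nhds.congr' ?_
          filter_upwards [Filter.eventually_ge_atTop i] with n hn
          exact hz n i (by omega)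
        exact ((hU k).1.preimage hg).mem_of_tendsto hlim (Filter.Eventually.of_forall hzk)
      by_contra hne
      obtain ⟨_, ⟨k, rfl⟩, hxk, hk⟩ := hSb.exists_subset_of_mem_open
        (show x ∈ ({g y}ᶜ : Set X) from fun h => hne h.symm) isOpen_compl_singleton
      exact hk (hmem k hxk) rfl

end Scheme

/-! ### Kleene–Brouwer orders and infinite branches -/

section KleeneBrouwer

/-- The Kleene–Brouwer order on finite sequences: end extensions come first, and otherwise
sequences are compared at the first difference. -/
def kleeneBrouwer (s : List ℕ) : (List ℕᵒᵈ)ᵒᵈ := OrderDual.toDual (s.map OrderDual.toDual)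

theorem kleeneBrouwer_injective : Function.Injective kleeneBrouwer :=
  OrderDual.toDual.injective.comp (List.map_injective_iff.2 OrderDual.toDual.injective)

theorem kleeneBrouwer_cons_lt_nil (n : ℕ) (s : List ℕ) :
    kleeneBrouwer (n :: s) < kleeneBrouwer [] :=
  OrderDual.toDual_lt_toDual.2 List.Lex.nil

theorem kleeneBrouwer_cons_lt_cons {n m : ℕ} (h : n < m) (s t : List ℕ) :
    kleeneBrouwer (n :: s) < kleeneBrouwer (m :: t) :=
  OrderDual.toDual_lt_toDual.2 (List.Lex.rel h)

theorem kleeneBrouwer_cons_le_cons (n : ℕ) {s t : List ℕ} (h : kleeneBrouwer s ≤ kleeneBrouwer t) :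
    kleeneBrouwer (n :: s) ≤ kleeneBrouwer (n :: t) := by
  rcases h.eq_or_lt with h | h
  · rw [kleeneBrouwer_injective h]
  · exact le_of_lt (OrderDual.toDual_lt_toDual.2 (List.Lex.cons h))

theorem kleeneBrouwer_append_singleton_lt (s : List ℕ) (n : ℕ) :
    kleeneBrouwer (s ++ [n]) < kleeneBrouwer s := by
  induction s with
  | nil => exact kleeneBrouwer_cons_lt_nil n []
  | cons m s ih => exact OrderDual.toDual_lt_toDual.2 (List.Lex.cons ih)

/-- Each nonempty set of nodes of `T` has a Kleene–Brouwer least element. -/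
def IsKleeneBrouwerWellOrdered (T : Set (List ℕ)) : Prop :=
  ∀ A ⊆ T, A.Nonempty → ∃ m ∈ A, ∀ s ∈ A, kleeneBrouwer m ≤ kleeneBrouwer s

/-- Sequences with the least occurring first entry precede all others, the empty sequence being
last; so a minimum among their tails suffices. -/
theorem isKleeneBrouwerWellOrdered_of_forall_cons {T : Set (List ℕ)}
    (h : ∀ n, IsKleeneBrouwerWellOrdered {s | n :: s ∈ T}) : IsKleeneBrouwerWellOrdered T := by
  classical
  intro A hAT hA
  by_cases hc : ∃ n s, n :: s ∈ A
  · obtain ⟨s, hs, hmin⟩ := h (Nat.find hc) {s | Nat.find hc :: s ∈ A} (fun s hs => hAT hs)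
      (Nat.find_spec hc)
    refine ⟨_, hs, ?_⟩
    rintro (_ | ⟨k, t⟩) ht
    · exact (kleeneBrouwer_cons_lt_nil _ _).le
    · rcases (Nat.find_min' hc ⟨t, ht⟩).eq_or_lt with hk | hk
      · subst hk
        exact kleeneBrouwer_cons_le_cons _ (hmin t ht)
      · exact (kleeneBrouwer_cons_lt_cons hk _ _).le
  · have hnil : ∀ s ∈ A, s = [] := by
      rintro (_ | ⟨n, s⟩) hs
      · rfl
      · exact absurd ⟨n, s, hs⟩ hc
    obtain ⟨s, hs⟩ := hA
    exact ⟨s, hs, fun t ht => by rw [hnil s hs, hnil t ht]⟩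

/-- By the previous lemma a bad node has a bad child, and iterating this traces a branch. It stays
in `T` because a bad node has an extension in `T`. -/
theorem exists_branch_of_not_isKleeneBrouwerWellOrdered {T : Set (List ℕ)}
    (hT : ∀ s t, s ++ t ∈ T → s ∈ T) (h : ¬ IsKleeneBrouwerWellOrdered T) :
    ∃ y : ℕ → ℕ, ∀ n, (List.range n).map y ∈ T := by
  have step : ∀ s : {s : List ℕ // ¬ IsKleeneBrouwerWellOrdered {u | s ++ u ∈ T}},
      ∃ n, ¬ IsKleeneBrouwerWellOrdered {u | (s.1 ++ [n]) ++ u ∈ T} := by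
    rintro ⟨s, hs⟩
    by_contra! hn
    exact hs (isKleeneBrouwerWellOrdered_of_forall_cons fun n => by simpa using hn n)
  choose c hc using step
  let σ : ℕ → {s : List ℕ // ¬ IsKleeneBrouwerWellOrdered {u | s ++ u ∈ T}} := fun k =>
    k.rec ⟨[], h⟩ fun _ s => ⟨s.1 ++ [c s], hc s⟩
  have hσ : ∀ k, (σ k).1 = (List.range k).map (fun i => c (σ i)) := by
    intro k
    induction k with
    | zero => rfl
    | succ k ih =>
      rw [List.range_succ, List.map_append, ← ih]
      rfl
  refine ⟨fun i => c (σ i), fun n => ?_⟩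
  rw [← hσ n]
  by_contra hn
  refine (σ n).2 fun A hA ⟨u, hu⟩ => absurd (hT _ _ (hA hu)) hn

/-- The order type `ω` of the sequences outside `T`, followed by the Kleene–Brouwer order of `T`. -/
noncomputable def paddedKleeneBrouwer (T : Set (List ℕ)) (s : List ℕ) : ℕ ⊕ₗ (List ℕᵒᵈ)ᵒᵈ :=
  open Classical in
  if s ∈ T then toLex (.inr (kleeneBrouwer s)) else toLex (.inl (Encodable.encode s))

variable {T : Set (List ℕ)} {s t : List ℕ}

theorem paddedKleeneBrouwer_of_mem (h : s ∈ T) :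
    paddedKleeneBrouwer T s = toLex (.inr (kleeneBrouwer s)) := if_pos h

theorem paddedKleeneBrouwer_of_notMem (h : s ∉ T) :
    paddedKleeneBrouwer T s = toLex (.inl (Encodable.encode s)) := if_neg h

theorem paddedKleeneBrouwer_injective (T : Set (List ℕ)) :
    Function.Injective (paddedKleeneBrouwer T) := by
  intro s t h
  by_cases hs : s ∈ T <;> by_cases ht : t ∈ T <;>
    simp only [paddedKleeneBrouwer_of_mem, paddedKleeneBrouwer_of_notMem, hs, ht,
      not_false_eq_true, EmbeddingLike.apply_eq_iff_eq, Sum.inr.injEq, Sum.inl.injEq,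
      reduceCtorEq] at h
  · exact kleeneBrouwer_injective h
  · exact Encodable.encode_injective h

/-- The comparison depends on `T` only through the membership of `s` and `t`, which later gives
continuity. Ordering all sequences, not just those in `T`, keeps the domain fixed. -/
theorem paddedKleeneBrouwer_le_iff : paddedKleeneBrouwer T s ≤ paddedKleeneBrouwer T t ↔
    (s ∉ T ∧ t ∈ T) ∨ (s ∉ T ∧ t ∉ T ∧ Encodable.encode s ≤ Encodable.encode t) ∨
      (s ∈ T ∧ t ∈ T ∧ kleeneBrouwer s ≤ kleeneBrouwer t) := by
  by_cases hs : s ∈ T <;> by_cases ht : t ∈ T <;>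
    simp [paddedKleeneBrouwer_of_mem, paddedKleeneBrouwer_of_notMem, hs, ht]

theorem wellFounded_paddedKleeneBrouwer_iff (hT : ∀ s t, s ++ t ∈ T → s ∈ T) :
    WellFounded (InvImage (· < ·) (paddedKleeneBrouwer T)) ↔
      ¬ ∃ y : ℕ → ℕ, ∀ n, (List.range n).map y ∈ T := by
  constructor
  · rintro hw ⟨y, hy⟩
    have hlt : ∀ n, paddedKleeneBrouwer T ((List.range (n + 1)).map y) <
        paddedKleeneBrouwer T ((List.range n).map y) := by
      intro n
      rw [paddedKleeneBrouwer_of_mem (hy _), paddedKleeneBrouwer_of_mem (hy _),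
        Sum.Lex.inr_lt_inr_iff, List.range_succ, List.map_append]
      exact kleeneBrouwer_append_singleton_lt _ _
    obtain ⟨_, ⟨n, rfl⟩, hn⟩ := hw.has_min (range fun n => (List.range n).map y) ⟨_, 0, rfl⟩
    exact hn _ ⟨n + 1, rfl⟩ (hlt n)
  · intro hb
    have hw : IsKleeneBrouwerWellOrdered T := by
      by_contra h
      exact hb (exists_branch_of_not_isKleeneBrouwerWellOrdered hT h)
    refine WellFounded.wellFounded_iff_has_min.2 fun A hA => ?_
    by_cases hAT : A ⊆ T
    · obtain ⟨m, hm, hmin⟩ := hw A hAT hA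
      refine ⟨m, hm, fun s hs => not_lt.2 ?_⟩
      exact paddedKleeneBrouwer_le_iff.2 (.inr (.inr ⟨hAT hm, hAT hs, hmin s hs⟩))
    · obtain ⟨s, hsA, hsT⟩ := not_subset.1 hAT
      obtain ⟨m, ⟨hm, hmT⟩, hmin⟩ :=
        (InvImage.wf (Encodable.encode : List ℕ → ℕ) Nat.lt_wfRel.wf).has_min (A \ T) ⟨s, hsA, hsT⟩
      refine ⟨m, hm, fun t ht => not_lt.2 (paddedKleeneBrouwer_le_iff.2 ?_)⟩
      by_cases htT : t ∈ T
      · exact .inl ⟨hmT, htT⟩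
      · exact .inr (.inl ⟨hmT, htT, not_lt.1 (hmin t ⟨ht, htT⟩)⟩)

end KleeneBrouwer

/-! ### Continuous reductions into the space of codes, and upper bounds -/

namespace LO

/-- The code of the order induced on `ℕ` by an injection into a linear order. -/
noncomputable def ofInjective {α : Type*} [LinearOrder α] (f : ℕ → α) (hf : Function.Injective f) :
    LO :=
  ⟨fun p => decide (f p.1 ≤ f p.2), fun n => by simp,
    fun n m h h' => hf (le_antisymm (by simpa using h) (by simpa using h')),
    fun n m k h h' => by
      simp only [decide_eq_true_eq] at h h' ⊢
      exact h.trans h',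
    fun n m => by simpa using le_total _ _⟩

variable {α : Type*} [LinearOrder α]

theorem le_iff (L : LO) (n m : L.Dom) : n ≤ m ↔ L.1 (n, m) = true := Iff.rfl

theorem ofInjective_le_iff {f : ℕ → α} {hf : Function.Injective f} {n m : (ofInjective f hf).Dom} :
    n ≤ m ↔ f n ≤ f m := by
  rw [le_iff]
  exact decide_eq_true_iff

theorem ofInjective_lt_iff {f : ℕ → α} {hf : Function.Injective f} {n m : (ofInjective f hf).Dom} :
    n < m ↔ f n < f m := by
  rw [← not_le, ofInjective_le_iff, not_le]

/-- The order coded by means of a bijection is isomorphic to the given one. -/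
noncomputable def ofInjectiveIso (e : ℕ ≃ α) : (ofInjective e e.injective).Dom ≃o α where
  toEquiv := e
  map_rel_iff' := ofInjective_le_iff.symm

instance (L : LO) : Countable L.Dom := inferInstanceAs (Countable ℕ)

variable {X : Type*} [TopologicalSpace X]

theorem continuous_iff_isClopen {F : X → LO} :
    Continuous F ↔ ∀ n m : ℕ, IsClopen {x | (F x).1 (n, m) = true} := by
  rw [continuous_induced_rng, continuous_pi_iff]
  refine ⟨fun h n m => (isClopen_discrete {true}).preimage (h (n, m)), fun h p => ?_⟩
  exact (continuous_bool_rng true).2 (h p.1 p.2)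

theorem isClopen_setOf_le {F : X → LO} (hF : Continuous F) (n m : ℕ) :
    IsClopen {x | @LE.le (F x).Dom _ n m} := continuous_iff_isClopen.1 hF n m

/-- For fixed finite sets, the comparison consults only finitely many entries of the code. -/
theorem isClopen_setOf_colex_le {F : X → LO} (hF : Continuous F) (s t : Colex (Finset ℕ)) :
    IsClopen {x | @LE.le (Colex (Finset (F x).Dom)) _ s t} := by
  have : {x | @LE.le (Colex (Finset (F x).Dom)) _ s t} =
      ⋂ a ∈ ofColex s \ ofColex t, ⋃ b ∈ ofColex t \ ofColex s,
        {x | @LE.le (F x).Dom _ a b} := by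
    ext x
    simp only [mem_ofPred_eq, mem_iInter, mem_iUnion, Finset.mem_sdiff, exists_prop]
    refine ⟨fun h a ha => ?_, fun h a ha ha' => ?_⟩
    · obtain ⟨b, hb, hb', hab⟩ := h ha.1 ha.2
      exact ⟨b, ⟨hb, hb'⟩, hab⟩
    · obtain ⟨b, ⟨hb, hb'⟩, hab⟩ := h a ⟨ha, ha'⟩
      exact ⟨b, hb, hb', hab⟩
  rw [this]
  exact isClopen_biInter_finset fun a _ => isClopen_biUnion_finset fun b _ =>
    isClopen_setOf_le hF a b

theorem isClopen_setOf_doubledColex_le {F : X → LO} (hF : Continuous F) (p q : DoubledColex ℕ) :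
    IsClopen {x | @LE.le (DoubledColex (F x).Dom) _ p q} := by
  have : {x | @LE.le (DoubledColex (F x).Dom) _ p q} =
      {x | @LE.le (Colex (Finset (F x).Dom)) _ (ofLex q).1 (ofLex p).1}ᶜ ∪
        {_x | (ofLex p).1 = (ofLex q).1 ∧ (ofLex p).2 ≤ (ofLex q).2} := by
    ext x
    refine (Prod.Lex.le_iff (α := Colex (Finset (F x).Dom)) (β := Bool)).trans ?_
    simp only [mem_union, mem_compl_iff, mem_ofPred_eq]
    exact or_congr_left not_le.symm
  rw [this]
  exact (isClopen_setOf_colex_le hF _ _).compl.union (isClopen_setOf_const _)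

theorem isClopen_setOf_separatedSum_le {F G : X → LO} (hF : Continuous F) (hG : Continuous G)
    (p q : SeparatedSum ℚ ℕ ℕ) :
    IsClopen {x | @LE.le (SeparatedSum ℚ (F x).Dom (G x).Dom) _ p q} := by
  have hT : ∀ {P : X → Prop}, (∀ x, P x) → IsClopen {x | P x} := fun h => by
    simp [h, isClopen_univ]
  have hN : ∀ {P : X → Prop}, (∀ x, ¬ P x) → IsClopen {x | P x} := fun h => by
    simp [h, isClopen_empty]
  have outer (x : X) (a b : (DoubledColex (G x).Dom)ᵒᵈ) :=
    Sum.Lex.inl_le_inl_iff (β := ℚ ⊕ₗ DoubledColex (F x).Dom) (a := a) (b := b)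
  have outer_le (x : X) (a : (DoubledColex (G x).Dom)ᵒᵈ) (b : ℚ ⊕ₗ DoubledColex (F x).Dom) :=
    Sum.Lex.inl_le_inr a b
  have outer_not (x : X) (a : (DoubledColex (G x).Dom)ᵒᵈ) (b : ℚ ⊕ₗ DoubledColex (F x).Dom) :=
    Sum.Lex.not_inr_le_inl (a := a) (b := b)
  have inner (x : X) (a b : ℚ ⊕ₗ DoubledColex (F x).Dom) :=
    Sum.Lex.inr_le_inr_iff (α := (DoubledColex (G x).Dom)ᵒᵈ) (a := a) (b := b)
  rcases p with a | a | a <;> rcases q with b | b | b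
  -- The first summand is reversed, hence the swap of `a` and `b`.
  · convert isClopen_setOf_doubledColex_le hG b a using 2
    exact Set.ext fun x => outer x a b
  · exact hT fun x => outer_le x _ _
  · exact hT fun x => outer_le x _ _
  · exact hN fun x => outer_not x _ _
  · convert isClopen_setOf_const (X := X) (a ≤ b) using 2
    exact Set.ext fun x => (inner x _ _).trans
      (Sum.Lex.inl_le_inl_iff (β := DoubledColex (F x).Dom))
  · exact hT fun x => (inner x _ _).2 (Sum.Lex.inl_le_inr (β := DoubledColex (F x).Dom) _ _)
  · exact hN fun x => outer_not x _ _
  · exact hN fun x h => Sum.Lex.not_inr_le_inl (β := DoubledColex (F x).Dom) ((inner x _ _).1 h)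
  · convert isClopen_setOf_doubledColex_le hF a b using 2
    exact Set.ext fun x => (inner x _ _).trans
      (Sum.Lex.inr_le_inr_iff (β := DoubledColex (F x).Dom))

instance : Countable (SeparatedSum ℚ ℕ ℕ) :=
  inferInstanceAs (Countable ((Finset ℕ × Bool) ⊕ (ℚ ⊕ (Finset ℕ × Bool))))

instance : Infinite (SeparatedSum ℚ ℕ ℕ) :=
  inferInstanceAs (Infinite ((Finset ℕ × Bool) ⊕ (ℚ ⊕ (Finset ℕ × Bool))))

/-- An enumeration of the domain of the separated sum of two coded orders. -/
noncomputable def separatedSumEquiv : ℕ ≃ SeparatedSum ℚ ℕ ℕ :=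
  Classical.choice (nonempty_equiv_of_countable (α := ℕ) (β := SeparatedSum ℚ ℕ ℕ))

/-- The code of the separated sum of the orders coded by `L` and `M`. -/
noncomputable def separatedSum (L M : LO) : LO :=
  ofInjective (α := SeparatedSum ℚ L.Dom M.Dom) separatedSumEquiv separatedSumEquiv.injective

theorem _root_.Continuous.separatedSum {F G : X → LO} (hF : Continuous F) (hG : Continuous G) :
    Continuous fun x => separatedSum (F x) (G x) := by
  refine continuous_iff_isClopen.2 fun n m => ?_
  convert isClopen_setOf_separatedSum_le hF hG (separatedSumEquiv n) (separatedSumEquiv m) using 1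
  ext x
  exact ofInjective_le_iff (α := SeparatedSum ℚ (F x).Dom (G x).Dom)
    (hf := separatedSumEquiv.injective)

theorem separatedSum_mem_LOr {L M : LO} : separatedSum L M ∈ LOr ↔ ¬ WellFoundedLT L.Dom :=
  (ofInjectiveIso (α := SeparatedSum ℚ L.Dom M.Dom) separatedSumEquiv).rightCompressible_iff.trans
    rightCompressible_separatedSum_iff

theorem separatedSum_mem_LOl {L M : LO} : separatedSum L M ∈ LOl ↔ ¬ WellFoundedLT M.Dom :=
  (ofInjectiveIso (α := SeparatedSum ℚ L.Dom M.Dom) separatedSumEquiv).leftCompressible_iff.trans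
    leftCompressible_separatedSum_iff

/-- An analytic subset of a zero-dimensional space reduces to the set of ill-founded orders. -/
theorem _root_.MeasureTheory.AnalyticSet.exists_continuous_not_wellFoundedLT [PolishSpace X]
    (hX : IsZeroDimensional X) {B : Set X} (hB : AnalyticSet B) :
    ∃ F : X → LO, Continuous F ∧ ∀ x, x ∈ B ↔ ¬ WellFoundedLT (F x).Dom := by
  obtain ⟨C, hC, hanti, hBC⟩ := hB.exists_clopen_scheme hX
  let e : ℕ ≃ List ℕ := (Denumerable.eqv (List ℕ)).symm
  let T : X → Set (List ℕ) := fun x => {s | x ∈ C s}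
  refine ⟨fun x => ofInjective (paddedKleeneBrouwer (T x) ∘ e)
    ((paddedKleeneBrouwer_injective (T x)).comp e.injective), ?_, fun x => ?_⟩
  · refine continuous_iff_isClopen.2 fun n m => ?_
    have h : {x | (ofInjective (paddedKleeneBrouwer (T x) ∘ e)
        ((paddedKleeneBrouwer_injective (T x)).comp e.injective)).1 (n, m) = true} =
        ((C (e n))ᶜ ∩ C (e m)) ∪
          (((C (e n))ᶜ ∩ ((C (e m))ᶜ ∩ {_x | Encodable.encode (e n) ≤ Encodable.encode (e m)})) ∪
          (C (e n) ∩ (C (e m) ∩ {_x | kleeneBrouwer (e n) ≤ kleeneBrouwer (e m)}))) := by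
      ext x
      exact decide_eq_true_iff.trans paddedKleeneBrouwer_le_iff
    rw [h]
    have hn := hC (e n)
    have hm := hC (e m)
    exact (hn.compl.inter hm).union ((hn.compl.inter (hm.compl.inter (isClopen_setOf_const _))).union
      (hn.inter (hm.inter (isClopen_setOf_const _))))
  · rw [hBC, WellFoundedLT, isWellFounded_iff]
    have hT : ∀ s t, s ++ t ∈ T x → s ∈ T x := fun s t h => hanti s t h
    rw [← not_iff_not, not_not, ← show _ ↔ ¬ ∃ y : ℕ → ℕ, ∀ n, x ∈ C ((List.range n).map y) from
      wellFounded_paddedKleeneBrouwer_iff hT]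
    let f : (InvImage (· < ·) (paddedKleeneBrouwer (T x) ∘ e)) ≃r
        InvImage (· < ·) (paddedKleeneBrouwer (T x)) := ⟨e, Iff.rfl⟩
    have hr : ((· < ·) : (ofInjective (paddedKleeneBrouwer (T x) ∘ e)
        ((paddedKleeneBrouwer_injective (T x)).comp e.injective)).Dom → _ → Prop) =
        InvImage (· < ·) (paddedKleeneBrouwer (T x) ∘ e) := by
      ext n m
      exact ofInjective_lt_iff
    rw [hr]
    exact ⟨fun h => f.toRelEmbedding.wellFounded h, fun h => f.symm.toRelEmbedding.wellFounded h⟩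

/-- `S` collects the pairs of a code and an embedding onto a proper initial segment. Its defining
clauses combine clopen conditions by countable operations, so it is Borel, and `LOr` is its
projection. -/
theorem analyticSet_LOr : AnalyticSet LOr := by
  let S : Set (LO × (ℕ → ℕ)) := {p | (∀ n m, p.1.1 (n, m) = p.1.1 (p.2 n, p.2 m)) ∧
    (∀ n k, p.1.1 (k, p.2 n) = true → ∃ m, p.2 m = k) ∧ ∃ k, ∀ n, p.2 n ≠ k}
  have hcl : ∀ {P : LO × (ℕ → ℕ) → Prop}, (∀ p, ∀ᶠ q in 𝓝 p, P q ↔ P p) → IsClopen {p | P p} := by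
    intro P h
    refine ⟨⟨isOpen_iff_mem_nhds.2 fun p hp => ?_⟩, isOpen_iff_mem_nhds.2 fun p hp => ?_⟩
    · filter_upwards [h p] with q hq using fun hq' => hp (hq.1 hq')
    · filter_upwards [h p] with q hq using hq.2 hp
  have hev : ∀ n : ℕ, ∀ p : LO × (ℕ → ℕ), ∀ᶠ q in 𝓝 p, q.2 n = p.2 n := fun n p =>
    (((continuous_apply n).comp continuous_snd).tendsto p).eventually
      (isOpen_discrete {p.2 n} |>.mem_nhds rfl)
  have hco : ∀ a : ℕ × ℕ, ∀ p : LO × (ℕ → ℕ), ∀ᶠ q in 𝓝 p, q.1.1 a = p.1.1 a := fun a p =>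
    (((continuous_apply a).comp (continuous_subtype_val.comp continuous_fst)).tendsto p).eventually
      (isOpen_discrete {p.1.1 a} |>.mem_nhds rfl)
  have hS : @MeasurableSet _ (borel _) S := by
    borelize (LO × (ℕ → ℕ))
    have h1 : ∀ n m : ℕ, IsClopen {p : LO × (ℕ → ℕ) | p.1.1 (n, m) = p.1.1 (p.2 n, p.2 m)} := by
      -- The entry consulted depends on the map, but its values at `n` and `m` are locally constant.
      refine fun n m => hcl fun p => ?_
      filter_upwards [hev n p, hev m p, hco (n, m) p, hco (p.2 n, p.2 m) p] with q h1 h2 h3 h4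
      rw [h1, h2, h3, h4]
    have h2 : ∀ n k : ℕ, IsClopen {p : LO × (ℕ → ℕ) | p.1.1 (k, p.2 n) = true} := by
      refine fun n k => hcl fun p => ?_
      filter_upwards [hev n p, hco (k, p.2 n) p] with q h1 h2
      rw [h1, h2]
    have h3 : ∀ n k : ℕ, IsClopen {p : LO × (ℕ → ℕ) | p.2 n = k} := by
      refine fun n k => hcl fun p => ?_
      filter_upwards [hev n p] with q h1
      rw [h1]
    have e : S = (⋂ n, ⋂ m, {p | p.1.1 (n, m) = p.1.1 (p.2 n, p.2 m)}) ∩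
        ((⋂ n, ⋂ k, ({p | p.1.1 (k, p.2 n) = true}ᶜ ∪ ⋃ m, {p | p.2 m = k})) ∩
          ⋃ k, ⋂ n, {p | p.2 n = k}ᶜ) := by
      ext p
      simp only [S, mem_inter_iff, mem_iInter, mem_iUnion, mem_union, mem_compl_iff,
        mem_ofPred_eq, imp_iff_not_or, ne_eq]
    rw [e]
    exact .inter (.iInter fun n => .iInter fun m => (h1 n m).isClosed.measurableSet)
      (.inter (.iInter fun n => .iInter fun k => .union (h2 n k).isClosed.measurableSet.compl
        (.iUnion fun m => (h3 m k).isClosed.measurableSet))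
        (.iUnion fun k => .iInter fun n => (h3 n k).isClosed.measurableSet.compl))
  have himage : LOr = Prod.fst '' S := by
    ext L
    refine rightCompressible_iff_exists_orderEmbedding.trans ⟨?_, ?_⟩
    · rintro ⟨f, hf, hs⟩
      refine ⟨(L, f), ⟨fun n m => ?_, fun n k hk => hf (a := f n) hk ⟨n, rfl⟩, ?_⟩, rfl⟩
      · exact Bool.eq_iff_iff.2 (f.le_iff_le (a := n) (b := m)).symm
      · simp only [Function.Surjective, not_forall, not_exists] at hs
        exact hs
    · rintro ⟨⟨L, f⟩, ⟨h1, h2, k, hk⟩, rfl⟩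
      refine ⟨OrderEmbedding.ofMapLEIff (α := L.Dom) (β := L.Dom) f
        fun n m => (Bool.eq_iff_iff.1 (h1 n m)).symm, ?_, fun hs => ?_⟩
      · rintro _ k hk ⟨n, rfl⟩
        exact h2 n k hk
      · obtain ⟨n, hn⟩ := hs k
        exact hk n hn
  rw [himage]
  borelize (LO × (ℕ → ℕ))
  exact hS.analyticSet.image_of_continuous continuous_fst

/-- The code of the reversed order. -/
def reverse (L : LO) : LO :=
  ⟨fun p => L.1 p.swap, L.2.1, fun n m h h' => L.2.2.1 n m h' h,
    fun n m k h h' => L.2.2.2.1 k m n h' h, fun n m => L.2.2.2.2 m n⟩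

theorem continuous_reverse : Continuous reverse :=
  continuous_iff_isClopen.2 fun n m => continuous_iff_isClopen.1 continuous_id m n

theorem preimage_reverse_LOr : reverse ⁻¹' LOr = LOl := by
  ext L
  let e : (reverse L).Dom ≃o (L.Dom)ᵒᵈ := ⟨OrderDual.toDual, Iff.rfl⟩
  exact e.rightCompressible_iff.trans leftCompressible_iff_rightCompressible_orderDual.symm

theorem analyticSet_LOl : AnalyticSet LOl := by
  rw [← preimage_reverse_LOr]
  exact analyticSet_LOr.preimage continuous_reverse

theorem analyticSet_LOr_inter_LOl : AnalyticSet (LOr ∩ LOl) := by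
  rw [inter_eq_iInter]
  exact .iInter (Bool.forall_bool.2 ⟨analyticSet_LOl, analyticSet_LOr⟩)

theorem analyticSet_LOr_union_LOl : AnalyticSet (LOr ∪ LOl) := by
  rw [union_eq_iUnion]
  exact .iUnion (Bool.forall_bool.2 ⟨analyticSet_LOl, analyticSet_LOr⟩)

/-- Two analytic sets reduce simultaneously and independently to the sets of right compressible
and of left compressible orders. -/
theorem exists_continuous_mem_LOr_mem_LOl [PolishSpace X] (hX : IsZeroDimensional X)
    {A B : Set X} (hA : AnalyticSet A) (hB : AnalyticSet B) :
    ∃ φ : X → LO, Continuous φ ∧ (∀ x, x ∈ A ↔ φ x ∈ LOr) ∧ ∀ x, x ∈ B ↔ φ x ∈ LOl := by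
  obtain ⟨F, hF, hFA⟩ := hA.exists_continuous_not_wellFoundedLT hX
  obtain ⟨G, hG, hGB⟩ := hB.exists_continuous_not_wellFoundedLT hX
  exact ⟨fun x => separatedSum (F x) (G x), hF.separatedSum hG,
    fun x => (hFA x).trans separatedSum_mem_LOr.symm,
    fun x => (hGB x).trans separatedSum_mem_LOl.symm⟩

end LO

/-- Hardness uses the pair (`B`, `B`) for `Σ¹₁`, the pair (`Bᶜ`, `Bᶜ`) for `Π¹₁`, and `S` together
with `Pᶜ` for `S ∩ P`, in either order. -/
theorem theorem3p18 :
    (IsClassComplete.{u} .sigma11 LOl ∧ IsClassComplete.{u} .sigma11 LOr ∧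
      IsClassComplete.{u} .sigma11 (LOr ∩ LOl)) ∧
    IsClassComplete.{u} .pi11 (LOr ∪ LOl)ᶜ ∧
    (IsClassComplete.{u} .d2pi11 (LOr \ LOl) ∧ IsClassComplete.{u} .d2pi11 (LOl \ LOr)) := by
  refine ⟨⟨⟨LO.analyticSet_LOl, ?_⟩, ⟨LO.analyticSet_LOr, ?_⟩,
    ⟨LO.analyticSet_LOr_inter_LOl, ?_⟩⟩, ⟨?_, ?_⟩,
    ⟨⟨LOr, LOlᶜ, LO.analyticSet_LOr, ?_, rfl⟩, ?_⟩,
    ⟨⟨LOl, LOrᶜ, LO.analyticSet_LOl, ?_, rfl⟩, ?_⟩⟩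
  · intro X _ _ hX B hB
    obtain ⟨φ, hφ, -, h⟩ := LO.exists_continuous_mem_LOr_mem_LOl hX hB hB
    exact ⟨φ, hφ, h⟩
  · intro X _ _ hX B hB
    obtain ⟨φ, hφ, h, -⟩ := LO.exists_continuous_mem_LOr_mem_LOl hX hB hB
    exact ⟨φ, hφ, h⟩
  · intro X _ _ hX B hB
    obtain ⟨φ, hφ, hr, hl⟩ := LO.exists_continuous_mem_LOr_mem_LOl hX hB hB
    exact ⟨φ, hφ, fun x => by rw [mem_inter_iff, ← hr, ← hl, and_self]⟩
  · change AnalyticSet (LOr ∪ LOl)ᶜᶜ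
    rw [compl_compl]
    exact LO.analyticSet_LOr_union_LOl
  · intro X _ _ hX B hB
    obtain ⟨φ, hφ, hr, hl⟩ := LO.exists_continuous_mem_LOr_mem_LOl hX hB hB
    exact ⟨φ, hφ, fun x => by
      rw [mem_compl_iff, mem_union, ← hr, ← hl, or_self, mem_compl_iff, not_not]⟩
  · rw [compl_compl]
    exact LO.analyticSet_LOl
  · rintro X _ _ hX B ⟨S, P, hS, hP, rfl⟩
    obtain ⟨φ, hφ, hr, hl⟩ := LO.exists_continuous_mem_LOr_mem_LOl hX hS hP
    exact ⟨φ, hφ, fun x => by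
      rw [mem_sdiff, ← hr, ← hl, mem_compl_iff, not_not, mem_inter_iff]⟩
  · rw [compl_compl]
    exact LO.analyticSet_LOr
  · rintro X _ _ hX B ⟨S, P, hS, hP, rfl⟩
    obtain ⟨φ, hφ, hr, hl⟩ := LO.exists_continuous_mem_LOr_mem_LOl hX hP hS
    exact ⟨φ, hφ, fun x => by
      rw [mem_sdiff, ← hr, ← hl, mem_compl_iff, not_not, mem_inter_iff]⟩
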